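/- Let $R$ be an associative ring with unity that is an algebra over a field $F$, with unit group $U(R)$. Let $\nabla(R)=\{a\in R : [U(R):C_{U(R)}(a)]<\infty\}$ be its FC-subring, let $\Delta U=\nabla(R)\cap U(R)=\{a\in U(R): [U(R):C_{U(R)}(a)]<\infty\}$ be the FC-radical of $U(R)$, and let $t(\Delta U)$ be the set of elements of finite order of $\Delta U$, which is a subgroup. An infinite subgroup $H$ of $U(R)$ is called an $\omega$-subgroup if, for all $x,y\in R$ with $xy-yx\neq 0$, the left annihilator of $xy-yx$ in $R$ contains only finitely many elements of the form $1-h$ with $h\in H$. A unit is called unipotent if it has the form $1+x$ with $x\in R$ nilpotent. Theorem 2. Assume that $U(R)$ contains an $\omega$-subgroup. Then: 1. every element of the commutator subgroup of $t(\Delta U)$ is unipotent and central in $\Delta U$; 2. if every element of $\nabla(R)$ is algebraic over $F$, then $\Delta U$ is nilpotent of class at most $2$; 3. $\Delta U$ is solvable of derived length at most $3$, and $t(\Delta U)$ is nilpotent of class at most $2$. -/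

import Mathlib

/-- The FC-radical (FC-centre) of a group `G`: the subgroup of all elements whose centralizer has
finite index, i.e. which have only finitely many conjugates. -/
def fcRadical (G : Type*) [Group G] : Subgroup G where
  carrier := {a | (Subgroup.centralizer {a}).FiniteIndex}
  one_mem' := by
    have h : Subgroup.centralizer {(1 : G)} = ⊤ := by
      ext g
      simp [Subgroup.mem_centralizer_singleton_iff]
    simp only [Set.mem_ofPred_eq, h]
    infer_instance
  mul_mem' := by
    intro a b ha hb
    simp only [Set.mem_ofPred_eq] at ha hb ⊢
    refine Subgroup.finiteIndex_of_le
      (H := Subgroup.centralizer {a} ⊓ Subgroup.centralizer {b}) ?_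
    rintro g ⟨h₁, h₂⟩
    have h₃ : Commute g a := Subgroup.mem_centralizer_singleton_iff.mp h₁
    have h₄ : Commute g b := Subgroup.mem_centralizer_singleton_iff.mp h₂
    exact Subgroup.mem_centralizer_singleton_iff.mpr (h₃.mul_right h₄)
  inv_mem' := by
    intro a ha
    simp only [Set.mem_ofPred_eq] at ha ⊢
    refine Subgroup.finiteIndex_of_le (H := Subgroup.centralizer {a}) ?_
    intro g h
    rw [Subgroup.mem_centralizer_singleton_iff] at h ⊢
    have h₃ : Commute g a := h
    exact h₃.inv_right

/-- Two elements of finite order with finitely many conjugates have a product of finite order: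
the centre of the subgroup they generate has finite index, so the transfer to this centre
is the homomorphism `g ↦ g ^ n` for some `n ≠ 0`. -/
theorem isOfFinOrder_mul_of_mem_fcRadical {G : Type*} [Group G] {a b : G}
    (ha : a ∈ fcRadical G) (hb : b ∈ fcRadical G)
    (ha' : IsOfFinOrder a) (hb' : IsOfFinOrder b) : IsOfFinOrder (a * b) := by
  let H : Subgroup G := Subgroup.closure {a, b}
  have ha₁ : (Subgroup.centralizer {a}).FiniteIndex := ha
  have hb₁ : (Subgroup.centralizer {b}).FiniteIndex := hb
  have hle : (Subgroup.centralizer {a} ⊓ Subgroup.centralizer {b}).subgroupOf H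
      ≤ Subgroup.center H := by
    rintro ⟨g, hg⟩ ⟨h₁, h₂⟩
    rw [Subgroup.mem_center_iff]
    rintro ⟨k, hk⟩
    apply Subtype.ext
    change k * g = g * k
    have h₁' : g * a = a * g := Subgroup.mem_centralizer_singleton_iff.mp h₁
    have h₂' : g * b = b * g := Subgroup.mem_centralizer_singleton_iff.mp h₂
    have hk' : k ∈ Subgroup.centralizer {g} := by
      refine (Subgroup.closure_le _).mpr ?_ hk
      rintro x (rfl | rfl)
      · exact Subgroup.mem_centralizer_singleton_iff.mpr h₁'.symm
      · exact Subgroup.mem_centralizer_singleton_iff.mpr h₂'.symm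
    exact Subgroup.mem_centralizer_singleton_iff.mp hk'
  have hfin : (Subgroup.center H).FiniteIndex := Subgroup.finiteIndex_of_le hle
  let x : H := ⟨a, Subgroup.subset_closure (by simp)⟩
  let y : H := ⟨b, Subgroup.subset_closure (by simp)⟩
  have hx : IsOfFinOrder x := Submonoid.isOfFinOrder_coe.mp ha'
  have hy : IsOfFinOrder y := Submonoid.isOfFinOrder_coe.mp hb'
  have hT : IsOfFinOrder (MonoidHom.transferCenterPow H (x * y)) := by
    rw [map_mul]
    exact (Commute.isOfFinOrder_mul (mul_comm' _ _)
      ((MonoidHom.transferCenterPow H).isOfFinOrder hx)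
      ((MonoidHom.transferCenterPow H).isOfFinOrder hy))
  have hT' : IsOfFinOrder ((x * y) ^ (Subgroup.center H).index) := by
    rw [← MonoidHom.transferCenterPow_apply]
    exact Submonoid.isOfFinOrder_coe.mpr hT
  have hxy : IsOfFinOrder (x * y) :=
    (isOfFinOrder_pow.mp hT').resolve_right Subgroup.FiniteIndex.index_ne_zero
  exact Submonoid.isOfFinOrder_coe.mpr hxy

/-- The torsion part `t(ΔG)` of the FC-radical `ΔG` of a group `G`: the subgroup of all elements
of finite order of `ΔG`. -/
def fcTorsion (G : Type*) [Group G] : Subgroup G where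
  carrier := {a | a ∈ fcRadical G ∧ IsOfFinOrder a}
  one_mem' := ⟨one_mem _, IsOfFinOrder.one⟩
  mul_mem' := fun ha hb =>
    ⟨mul_mem ha.1 hb.1, isOfFinOrder_mul_of_mem_fcRadical ha.1 hb.1 ha.2 hb.2⟩
  inv_mem' := fun ha => ⟨inv_mem ha.1, ha.2.inv⟩

/-- The centralizer `C_{U(R)}(a)` of an element `a` of a ring `R` in the unit group of `R`. -/
def unitCentralizer {R : Type*} [Ring R] (a : R) : Subgroup Rˣ where
  carrier := {u | Commute (u : R) a}
  one_mem' := by simp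
  mul_mem' := by
    intro u v hu hv
    simp only [Set.mem_ofPred_eq, Units.val_mul] at hu hv ⊢
    exact hu.mul_left hv
  inv_mem' := by
    intro u hu
    exact Commute.units_inv_left hu

/-- The FC-subring `∇(R)` of a ring `R`: the subring of all elements with only finitely many
conjugates under the unit group of `R`. -/
def fcSubring (R : Type*) [Ring R] : Subring R where
  carrier := {a | (unitCentralizer a).FiniteIndex}
  zero_mem' := Subgroup.finiteIndex_of_le (H := ⊤) fun _ _ => Commute.zero_right _
  one_mem' := Subgroup.finiteIndex_of_le (H := ⊤) fun _ _ => Commute.one_right _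
  add_mem' := by
    intro a b ha hb
    simp only [Set.mem_ofPred_eq] at ha hb ⊢
    exact Subgroup.finiteIndex_of_le (H := unitCentralizer a ⊓ unitCentralizer b)
      fun _ h => Commute.add_right h.1 h.2
  mul_mem' := by
    intro a b ha hb
    simp only [Set.mem_ofPred_eq] at ha hb ⊢
    exact Subgroup.finiteIndex_of_le (H := unitCentralizer a ⊓ unitCentralizer b)
      fun _ h => Commute.mul_right h.1 h.2
  neg_mem' := by
    intro a ha
    simp only [Set.mem_ofPred_eq] at ha ⊢
    exact Subgroup.finiteIndex_of_le (H := unitCentralizer a) fun _ h => Commute.neg_right h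

/-- An infinite subgroup `H` of the unit group of `R` is an `ω`-subgroup if the left annihilator
of each nonzero Lie commutator `x * y - y * x` contains only finitely many elements of the form
`1 - h` with `h ∈ H`. -/
def IsOmegaSubgroup {R : Type*} [Ring R] (H : Subgroup Rˣ) : Prop :=
  (H : Set Rˣ).Infinite ∧
    ∀ x y : R, x * y - y * x ≠ 0 →
      {r : R | r * (x * y - y * x) = 0 ∧ ∃ h ∈ H, r = 1 - (h : R)}.Finite

/-- A unit `u` of a ring `R` is unipotent if `u = 1 + x` with `x` nilpotent. -/
def IsUnipotentUnit {R : Type*} [Ring R] (u : Rˣ) : Prop :=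
  ∃ x : R, IsNilpotent x ∧ (u : R) = 1 + x

/-!
The engine is the following pigeonhole argument. An element `a` of the FC-subring commutes with a
quotient `v⁻¹ * w` of two units taken from any given infinite family, since its centralizer has
finite index in the unit group.

* For `x` nilpotent in the FC-subring, apply this to the units `1 + h * x`, where `h` runs over the
  elements of the `ω`-subgroup commuting with `x` and `a`. By induction on the nilpotency index the
  higher powers of `x` commute with `a`, and what remains is `(h - g) * (x * a - a * x) = 0` for
  infinitely many `h`, so the `ω`-property gives `x * a = a * x`. Hence nilpotent elements of the
  FC-subring are central in it (`IsOmegaSubgroup.commute_of_isNilpotent`).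
* If `F` is infinite, apply it to the units `l - b` with `b` algebraic and `l` a scalar: every
  algebraic element commutes with the FC-subring (`commute_of_isAlgebraic_of_infinite`).

If `F` is finite, two torsion FC-units `u`, `v` generate a finite group, hence span a finite
subalgebra of the FC-subring. Its nilpotents are central, so modulo its radical it is a finite
reduced ring, which is commutative by the theorems of Wedderburn–Artin and Wedderburn. So
`u * v - v * u` is nilpotent over any field (`IsOmegaSubgroup.isNilpotent_mul_sub_mul`), and
`⁅u, v⁆ - 1` is a nilpotent element of the FC-subring, thus central.

Everything else follows: the torsion part has class at most two; commutators of FC-elements are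
torsion, by transfer, so the second derived group of the FC-radical is central in it; and if the
FC-subring is algebraic, the FC-radical is abelian when `F` is infinite and torsion when `F` is
finite.
-/

open scoped commutatorElement

/-! ### The FC-subring and the pigeonhole principle -/

theorem mem_fcRadical_iff_val_mem_fcSubring {R : Type*} [Ring R] {u : Rˣ} :
    u ∈ fcRadical Rˣ ↔ (u : R) ∈ fcSubring R := by
  have h : Subgroup.centralizer {u} = unitCentralizer (u : R) := by
    ext g
    rw [Subgroup.mem_centralizer_singleton_iff, Units.ext_iff]
    rfl
  change (Subgroup.centralizer {u}).FiniteIndex ↔ (unitCentralizer (u : R)).FiniteIndex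
  rw [h]

theorem IsOmegaSubgroup.nontrivial {R : Type*} [Ring R] {H : Subgroup Rˣ}
    (hH : IsOmegaSubgroup H) : Nontrivial R := by
  by_contra h
  rw [not_nontrivial_iff_subsingleton] at h
  exact hH.1 (Set.toFinite _)

/-- A pigeonhole principle: the centralizer of `a` has finitely many cosets, so one of them contains
`f j` for infinitely many `j`. -/
theorem exists_infinite_commute_inv_mul {R ι : Type*} [Ring R] {a : R} (ha : a ∈ fcSubring R)
    {s : Set ι} (hs : s.Infinite) (f : ι → Rˣ) :
    ∃ i ∈ s, {j ∈ s | Commute (((f i)⁻¹ * f j : Rˣ) : R) a}.Infinite := by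
  have hfin : (unitCentralizer a).FiniteIndex := ha
  have : Infinite s := hs.to_subtype
  obtain ⟨y, hy⟩ := Finite.exists_infinite_fiber
    (fun i : s => (QuotientGroup.mk (f i) : Rˣ ⧸ unitCentralizer a))
  obtain ⟨i, hi⟩ := (Set.infinite_coe_iff.mp hy).nonempty
  refine ⟨i, i.2, ((Set.infinite_coe_iff.mp hy).image
    (Set.injOn_of_injective Subtype.val_injective)).mono ?_⟩
  rintro _ ⟨j, hj, rfl⟩
  refine ⟨j.2, ?_⟩
  have hij : (QuotientGroup.mk (f i) : Rˣ ⧸ unitCentralizer a) = QuotientGroup.mk (f j) :=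
    Eq.trans hi (Eq.symm hj)
  exact QuotientGroup.eq.mp hij

/-! ### Nilpotent elements of the FC-subring -/

/-- Let `w * (1 + g * x) = 1`, where `x` is nilpotent and commutes with `g`. If `a` commutes with
`g` and with all `x ^ k`, `k ≥ 2`, then it commutes with `w * c * x ^ k`, which is the finite
series `∑ i, (-g) ^ i * c * x ^ (k + i)`. -/
theorem commute_mul_mul_pow_of_commute_pow {R : Type*} [Ring R] {a x g w : R} {n : ℕ}
    (hx : x ^ n = 0) (hgx : Commute g x) (hga : Commute g a) (hw : w * (1 + g * x) = 1)
    (h2 : ∀ k, 2 ≤ k → Commute (x ^ k) a) (j : ℕ) :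
    ∀ (k : ℕ) (c : R), 2 ≤ k → n ≤ j + k → Commute c x → Commute c a →
      Commute (w * c * x ^ k) a := by
  induction j with
  | zero =>
    intro k c _ hk _ _
    rw [pow_eq_zero_of_le (by omega) hx, mul_zero]
    exact Commute.zero_left a
  | succ j ih =>
    intro k c h hk hcx hca
    have e : w * c * x ^ k = c * x ^ k - w * (g * c) * x ^ (k + 1) := by
      have hw' : w = 1 - w * g * x := by
        rw [eq_sub_iff_add_eq, mul_assoc, ← hw, mul_add, mul_one]
      have hcx' : x * c = c * x := hcx.eq.symm
      calc w * c * x ^ k = (1 - w * g * x) * c * x ^ k := by rw [← hw']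
        _ = c * x ^ k - w * g * (x * c) * x ^ k := by noncomm_ring
        _ = _ := by rw [hcx', pow_succ']; noncomm_ring
    rw [e]
    exact (hca.mul_left (h2 k h)).sub_left
      (ih (k + 1) (g * c) (by omega) (by omega) (hgx.mul_left hcx) (hga.mul_left hca))

/-- Nilpotent elements of the FC-subring are central in it. For infinitely many `h` in the
`ω`-subgroup commuting with `x` and `a`, the units `1 + h * x` lie in one coset of the centralizer
of `a`. If the higher powers of `x` commute with `a`, then for two such `g`, `h` this says
`(h - g) * (x * a - a * x) = 0`, so that a nonzero Lie commutator would have too many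
annihilators `1 - g⁻¹ * h`. -/
theorem IsOmegaSubgroup.commute_of_isNilpotent {R : Type*} [Ring R] {H : Subgroup Rˣ}
    (hH : IsOmegaSubgroup H) {x a : R} (hx : x ∈ fcSubring R) (ha : a ∈ fcSubring R)
    (hnil : IsNilpotent x) : Commute x a := by
  obtain ⟨n, hn⟩ := hnil
  induction n using Nat.strong_induction_on generalizing x with
  | _ n ih =>
  rcases Nat.lt_or_ge n 2 with hn2 | hn2
  · rw [← pow_one x, pow_eq_zero_of_le (by omega) hn]
    exact Commute.zero_left a
  -- For `k ≥ 2` the power `x ^ k` has a smaller nilpotency index than `n`.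
  have h2 : ∀ k, 2 ≤ k → Commute (x ^ k) a := by
    intro k hk
    refine ih (n - 1) (by omega) (pow_mem hx k) ?_
    rw [← pow_mul]
    refine pow_eq_zero_of_le ?_ hn
    calc n ≤ 2 * (n - 1) := by omega
      _ ≤ k * (n - 1) := Nat.mul_le_mul_right _ hk
  by_contra hxa
  have hfx : (unitCentralizer x).FiniteIndex := hx
  have hfa : (unitCentralizer a).FiniteIndex := ha
  let s : Set Rˣ := {h | h ∈ H ∧ Commute (h : R) x ∧ Commute (h : R) a}
  have hs : s.Infinite := by
    have : Infinite H := hH.1.to_subtype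
    have hK : Infinite ((unitCentralizer x ⊓ unitCentralizer a).subgroupOf H) := by
      by_contra hcon
      rw [not_infinite_iff_finite] at hcon
      have := (Subgroup.finite_iff_finite_and_finiteIndex
        ((unitCentralizer x ⊓ unitCentralizer a).subgroupOf H)).mpr ⟨hcon, inferInstance⟩
      exact not_finite H
    refine Set.infinite_of_injective_forall_mem
      (f := fun k : (unitCentralizer x ⊓ unitCentralizer a).subgroupOf H => (k.1.1 : Rˣ)) ?_ ?_
    · intro k l hkl
      exact Subtype.ext (Subtype.ext hkl)
    · intro k
      exact ⟨k.1.2, k.2.1, k.2.2⟩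
  have hunit : ∀ h : Rˣ, ∃ v : Rˣ, h ∈ s → (v : R) = 1 + h * x := by
    intro h
    by_cases hh : h ∈ s
    · obtain ⟨v, hv⟩ := (hh.2.1.isNilpotent_mul_left ⟨n, hn⟩).isUnit_one_add
      exact ⟨v, fun _ => hv⟩
    · exact ⟨1, fun h' => absurd h' hh⟩
  choose f hf using hunit
  obtain ⟨g, hg, hinf⟩ := exists_infinite_commute_inv_mul ha hs f
  have hann : ∀ h ∈ {h ∈ s | Commute (((f g)⁻¹ * f h : Rˣ) : R) a},
      (1 - ((g⁻¹ * h : Rˣ) : R)) * (x * a - a * x) = 0 := by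
    rintro h ⟨hh, hc⟩
    set w : R := (((f g)⁻¹ : Rˣ) : R) with hwdef
    have hw : w * (1 + g * x) = 1 := by rw [← hf g hg, hwdef, Units.inv_mul]
    have hw' : w = 1 - w * g * x := by
      rw [eq_sub_iff_add_eq, mul_assoc, ← hw, mul_add, mul_one]
    have hxg : x * g = g * x := hg.2.1.eq.symm
    have hxh : x * h = h * x := hh.2.1.eq.symm
    -- Modulo multiples of `x ^ 2` of the form controlled by `commute_mul_mul_pow_of_commute_pow`,
    -- the quotient of the two units is `1 + (h - g) * x`.
    have e : w * (1 + h * x) = 1 + (h - g) * x + w * (g * (g - h)) * x ^ 2 := by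
      have e1 : w * (1 + h * x) = w + w * h * x := by noncomm_ring
      have e2 : w * h * x = h * x - w * g * h * x ^ 2 := by
        calc w * h * x = (1 - w * g * x) * h * x := by rw [← hw']
          _ = h * x - w * g * (x * h) * x := by noncomm_ring
          _ = _ := by rw [hxh]; noncomm_ring
      have e3 : w = 1 - g * x + w * g * g * x ^ 2 := by
        calc w = 1 - w * g * x := hw'
          _ = 1 - (1 - w * g * x) * g * x := by rw [← hw']; exact hw'
          _ = 1 - g * x + w * g * (x * g) * x := by noncomm_ring
          _ = _ := by rw [hxg]; noncomm_ring
      rw [e1, e2]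
      nth_rewrite 1 [e3]
      noncomm_ring
    rw [Units.val_mul, hf h hh, ← hwdef, e] at hc
    have hc2 : Commute (w * (g * (g - h)) * x ^ 2) a :=
      commute_mul_mul_pow_of_commute_pow hn hg.2.1 hg.2.2 hw h2 n 2 _ le_rfl (by omega)
        (hg.2.1.mul_left (hg.2.1.sub_left hh.2.1)) (hg.2.2.mul_left (hg.2.2.sub_left hh.2.2))
    have hc3 : Commute ((h - g : R) * x) a := by
      have := (hc.sub_left hc2).sub_left (Commute.one_left a)
      simpa using this
    have hca : Commute (h - g : R) a := hh.2.2.sub_left hg.2.2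
    have h0 : (h - g : R) * (x * a - a * x) = 0 := by
      calc (h - g : R) * (x * a - a * x)
          = (h - g) * x * a - (h - g) * a * x := by noncomm_ring
        _ = 0 := by rw [hc3.eq, hca.eq, mul_assoc, sub_self]
    calc (1 - ((g⁻¹ * h : Rˣ) : R)) * (x * a - a * x)
        = - (((g⁻¹ : Rˣ) : R) * ((h - g : R) * (x * a - a * x))) := by
          rw [← mul_assoc, mul_sub ((g⁻¹ : Rˣ) : R), Units.inv_mul, ← Units.val_mul]
          noncomm_ring
      _ = 0 := by rw [h0, mul_zero, neg_zero]
  have hfin := hH.2 x a (sub_ne_zero.mpr hxa)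
  refine Set.Infinite.mono ?_ (hinf.image (f := fun h => 1 - ((g⁻¹ * h : Rˣ) : R)) ?_) hfin
  · rintro _ ⟨h, hh, rfl⟩
    exact ⟨hann h hh, g⁻¹ * h, H.mul_mem (H.inv_mem hg.1) hh.1.1, rfl⟩
  · intro h _ h' _ e
    exact mul_left_cancel (Units.ext (sub_right_injective e))

/-! ### Algebraic elements over an infinite field -/

/-- Over an infinite field, algebraic elements commute with the whole FC-subring: `l - b` is a unit
for almost all scalars `l`, and if `(l - b)⁻¹ * (m - b) = 1 + (m - l) * (l - b)⁻¹` commutes with `a`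
for some `l ≠ m`, so does `b`. -/
theorem commute_of_isAlgebraic_of_infinite {F R : Type*} [Field F] [Infinite F] [Ring R]
    [Nontrivial R] [Algebra F R] {a b : R} (ha : a ∈ fcSubring R) (hb : IsAlgebraic F b) :
    Commute a b := by
  obtain ⟨p, hp, hpb⟩ := hb
  have hs : (spectrum F b)ᶜ.Infinite := by
    refine ((Polynomial.finite_setOfPred_isRoot hp).subset ?_).infinite_compl
    intro l hl
    have := spectrum.subset_polynomial_aeval b p ⟨l, hl, rfl⟩
    rw [hpb, spectrum.zero_eq] at this
    exact this
  have hunit : ∀ l : F, ∃ v : Rˣ, l ∈ (spectrum F b)ᶜ → (v : R) = algebraMap F R l - b := by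
    intro l
    by_cases hl : l ∈ spectrum F b
    · exact ⟨1, fun h => absurd hl h⟩
    · obtain ⟨v, hv⟩ := spectrum.notMem_iff.mp hl
      exact ⟨v, fun _ => hv⟩
  choose f hf using hunit
  obtain ⟨l, hl, hinf⟩ := exists_infinite_commute_inv_mul ha hs f
  obtain ⟨m, ⟨hm, hc⟩, hml⟩ := hinf.exists_notMem_finset {l}
  rw [Finset.mem_singleton] at hml
  have hfm : (f m : R) = f l + algebraMap F R (m - l) := by
    rw [hf m hm, hf l hl, map_sub]; abel
  have hc1 : Commute ((((f l)⁻¹ : Rˣ) : R)) a := by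
    rw [Units.val_mul, hfm, mul_add, Units.inv_mul, ← Algebra.commutes, ← Algebra.smul_def] at hc
    have hc' := hc.sub_left (Commute.one_left a)
    rw [add_sub_cancel_left] at hc'
    have := hc'.smul_left (m - l)⁻¹
    rwa [smul_smul, inv_mul_cancel₀ (sub_ne_zero.mpr hml), one_smul] at this
  have hc2 : Commute (f l : R) a := Commute.units_inv_left_iff.mp hc1
  rw [hf l hl] at hc2
  have := (Algebra.commute_algebraMap_left l a).sub_left hc2
  rw [sub_sub_cancel] at this
  exact this.symm

/-! ### Finite rings with central nilpotents -/

/-- A finite reduced ring is commutative: by Wedderburn–Artin it is a product of matrix rings over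
finite division rings, which are fields; the matrices have size one because larger ones contain
nilpotents. -/
theorem Finite.mul_comm_of_isReduced {B : Type*} [Ring B] [Finite B] [IsReduced B] (x y : B) :
    x * y = y * x := by
  have hss : IsSemisimpleRing B := by
    rw [IsArtinianRing.isSemisimpleRing_iff_jacobson, eq_bot_iff]
    intro z hz
    obtain ⟨n, hn⟩ := IsSemiprimaryRing.isNilpotent (R := B)
    have : z ^ n ∈ (Ring.jacobson B) ^ n := Ideal.pow_mem_pow hz n
    rw [hn] at this
    exact (IsNilpotent.eq_zero ⟨n, this⟩ : z = 0)
  obtain ⟨n, D, d, _, hd, ⟨e⟩⟩ := IsSemisimpleRing.exists_ringEquiv_pi_matrix_divisionRing B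
  have hpi : Finite ((i : Fin n) → Matrix (Fin (d i)) (Fin (d i)) (D i)) := Finite.of_equiv B e
  have hred : IsReduced ((i : Fin n) → Matrix (Fin (d i)) (Fin (d i)) (D i)) :=
    isReduced_of_injective e.symm e.symm.injective
  apply e.injective
  rw [map_mul, map_mul]
  funext i
  -- An off-diagonal matrix unit would be a nonzero nilpotent.
  have hone : Subsingleton (Fin (d i)) := by
    refine ⟨fun j k => ?_⟩
    by_contra hjk
    have hnil : IsNilpotent (Pi.single i (Matrix.single j k 1) :
        (i : Fin n) → Matrix (Fin (d i)) (Fin (d i)) (D i)) := by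
      refine ⟨2, ?_⟩
      rw [pow_two, ← Pi.single_mul, Matrix.single_mul_single_of_ne _ _ _ _ (Ne.symm hjk),
        Pi.single_zero]
    have h0 := congrFun (congrFun (congrFun hnil.eq_zero i) j) k
    simp at h0
  have hDi : Finite (D i) := by
    refine Finite.of_injective (fun c : D i => (Pi.single i (Matrix.diagonal fun _ => c) :
      (i : Fin n) → Matrix (Fin (d i)) (Fin (d i)) (D i))) ?_
    intro c c' h
    have := congrFun (congrFun (congrFun h i) 0) 0
    simpa using this
  ext j k
  rw [Pi.mul_apply, Pi.mul_apply, Matrix.mul_apply, Matrix.mul_apply]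
  refine Finset.sum_congr rfl fun l _ => ?_
  rw [Subsingleton.elim l j, Subsingleton.elim k j]
  exact (littleWedderburn (D i)).mul_comm _ _

/-- In a finite ring with central nilpotents, Lie commutators are nilpotent, since the
quotient by the Jacobson radical, which is nilpotent, is finite and reduced. -/
theorem Finite.isNilpotent_mul_sub_mul {B : Type*} [Ring B] [Finite B]
    (hB : ∀ z : B, IsNilpotent z → ∀ b, Commute z b) (x y : B) :
    IsNilpotent (x * y - y * x) := by
  obtain ⟨n, hn⟩ := IsSemiprimaryRing.isNilpotent (R := B)
  have hJ : ∀ z ∈ Ring.jacobson B, IsNilpotent z := by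
    intro z hz
    have : z ^ n ∈ (Ring.jacobson B) ^ n := Ideal.pow_mem_pow hz n
    rw [hn] at this
    exact ⟨n, this⟩
  have hfin : Finite (B ⧸ Ring.jacobson B) :=
    Finite.of_surjective _ (Ideal.Quotient.mk_surjective (I := Ring.jacobson B))
  have hred : IsReduced (B ⧸ Ring.jacobson B) := by
    refine ⟨fun q hq => ?_⟩
    obtain ⟨z, rfl⟩ := Ideal.Quotient.mk_surjective q
    obtain ⟨k, hk⟩ := hq
    rw [← map_pow, Ideal.Quotient.eq_zero_iff_mem] at hk
    have hz : IsNilpotent z := (hJ _ hk).of_pow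
    rw [Ideal.Quotient.eq_zero_iff_mem, ← Ideal.jacobson_bot, Ideal.mem_jacobson_iff]
    intro y
    obtain ⟨w, hw⟩ := ((hB z hz y).symm.isNilpotent_mul_left hz).isUnit_add_one
    refine ⟨((w⁻¹ : Bˣ) : B), ?_⟩
    have := w.inv_mul
    rw [hw, mul_add, mul_one, ← mul_assoc] at this
    rw [this, sub_self]
    exact zero_mem _
  apply hJ
  rw [← Ideal.Quotient.eq_zero_iff_mem, map_sub, map_mul, map_mul, sub_eq_zero]
  exact Finite.mul_comm_of_isReduced _ _

/-! ### Subgroups generated by two FC-elements -/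

/-- The center of the subgroup generated by two FC-elements has finite index. -/
theorem finiteIndex_center_closure_pair {G : Type*} [Group G] {a b : G}
    (ha : a ∈ fcRadical G) (hb : b ∈ fcRadical G) :
    (Subgroup.center (Subgroup.closure {a, b})).FiniteIndex := by
  have ha₁ : (Subgroup.centralizer {a}).FiniteIndex := ha
  have hb₁ : (Subgroup.centralizer {b}).FiniteIndex := hb
  refine Subgroup.finiteIndex_of_le (H :=
    (Subgroup.centralizer {a} ⊓ Subgroup.centralizer {b}).subgroupOf (Subgroup.closure {a, b})) ?_
  rintro ⟨g, hg⟩ ⟨h₁, h₂⟩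
  rw [Subgroup.mem_center_iff]
  rintro ⟨k, hk⟩
  apply Subtype.ext
  have hle : Subgroup.closure {a, b} ≤ Subgroup.centralizer {g} := by
    rw [Subgroup.closure_le]
    rintro x (rfl | rfl)
    · exact Subgroup.mem_centralizer_singleton_iff.mpr
        (Subgroup.mem_centralizer_singleton_iff.mp h₁).symm
    · exact Subgroup.mem_centralizer_singleton_iff.mpr
        (Subgroup.mem_centralizer_singleton_iff.mp h₂).symm
  exact Subgroup.mem_centralizer_singleton_iff.mp (hle hk)

/-- The transfer into the center, `g ↦ g ^ n`, kills commutators. -/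
theorem isOfFinOrder_commutatorElement_of_mem_fcRadical {G : Type*} [Group G] {a b : G}
    (ha : a ∈ fcRadical G) (hb : b ∈ fcRadical G) : IsOfFinOrder ⁅a, b⁆ := by
  have := finiteIndex_center_closure_pair ha hb
  let x : Subgroup.closure {a, b} := ⟨a, Subgroup.subset_closure (by simp)⟩
  let y : Subgroup.closure {a, b} := ⟨b, Subgroup.subset_closure (by simp)⟩
  have h : IsOfFinOrder ⁅x, y⁆ := by
    rw [isOfFinOrder_iff_pow_eq_one]
    refine ⟨(Subgroup.center (Subgroup.closure {a, b})).index,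
      Nat.pos_of_ne_zero Subgroup.FiniteIndex.index_ne_zero, ?_⟩
    rw [← MonoidHom.transferCenterPow_apply, map_commutatorElement,
      commutatorElement_eq_one_iff_commute.mpr (mul_comm' _ _), Subgroup.coe_one]
  exact Submonoid.isOfFinOrder_coe.mpr h

open scoped IsMulCommutative in
/-- A special case of Dietzmann's lemma: the center has finite index and is a finitely generated
torsion abelian group. -/
theorem finite_closure_pair_of_mem_fcTorsion {G : Type*} [Group G] {a b : G}
    (ha : a ∈ fcTorsion G) (hb : b ∈ fcTorsion G) : Finite (Subgroup.closure {a, b}) := by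
  have := finiteIndex_center_closure_pair ha.1 hb.1
  have hfg : Group.FG (Subgroup.closure {a, b}) :=
    (Group.fg_iff_subgroup_fg _).mpr <|
      (Subgroup.fg_iff _).mpr ⟨{a, b}, rfl, Set.toFinite _⟩
  have hle : Subgroup.closure {a, b} ≤ fcTorsion G := by
    rw [Subgroup.closure_le]
    rintro x (rfl | rfl) <;> assumption
  have := Subgroup.fg_of_index_ne_zero (Subgroup.center (Subgroup.closure {a, b}))
  have htor : IsMulTorsion (Subgroup.center (Subgroup.closure {a, b})) := by
    intro z
    exact Submonoid.isOfFinOrder_coe.mp (Submonoid.isOfFinOrder_coe.mp (hle z.1.2).2)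
  have := CommGroup.finite_of_fg_isMulTorsion (Subgroup.center (Subgroup.closure {a, b})) htor
  exact (Subgroup.finite_iff_finite_and_finiteIndex
    (Subgroup.center (Subgroup.closure {a, b}))).mpr ⟨this, inferInstance⟩

/-! ### Commutators of torsion FC-units -/

theorem algebraMap_mem_fcSubring {F R : Type*} [Field F] [Ring R] [Algebra F R] (l : F) :
    algebraMap F R l ∈ fcSubring R :=
  Subgroup.finiteIndex_of_le (H := ⊤) fun _ _ => Algebra.commute_algebraMap_right _ _

/-- Over a finite field, `u` and `v` generate a finite subalgebra of the FC-subring, to which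
`Finite.isNilpotent_mul_sub_mul` applies. -/
theorem IsOmegaSubgroup.isNilpotent_mul_sub_mul_of_finite (F : Type*) {R : Type*} [Field F]
    [Finite F] [Ring R] [Algebra F R] {H : Subgroup Rˣ} (hH : IsOmegaSubgroup H) {u v : Rˣ}
    (hu : u ∈ fcTorsion Rˣ) (hv : v ∈ fcTorsion Rˣ) :
    IsNilpotent ((u : R) * v - v * u) := by
  let M : Submonoid R := (Subgroup.closure {u, v}).toSubmonoid.map (Units.coeHom R)
  have hfin : Finite (Subgroup.closure {u, v}) := finite_closure_pair_of_mem_fcTorsion hu hv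
  have hMfin : (M : Set R).Finite := by
    rw [Submonoid.coe_map]
    exact (Set.toFinite (Subgroup.closure {u, v} : Set Rˣ)).image _
  have huM : (u : R) ∈ M := ⟨u, Subgroup.subset_closure (by simp), rfl⟩
  have hvM : (v : R) ∈ M := ⟨v, Subgroup.subset_closure (by simp), rfl⟩
  have hM : ∀ z ∈ M, z ∈ fcSubring R := by
    have hle : Subgroup.closure {u, v} ≤ fcTorsion Rˣ := by
      rw [Subgroup.closure_le]
      rintro x (rfl | rfl) <;> assumption
    rintro _ ⟨w, hw, rfl⟩
    exact mem_fcRadical_iff_val_mem_fcSubring.mp (hle hw).1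
  let B : Subalgebra F R := Algebra.adjoin F (M : Set R)
  have hBfc : ∀ z ∈ B, z ∈ fcSubring R := by
    intro z hz
    induction hz using Algebra.adjoin_induction with
    | mem z hz => exact hM z hz
    | algebraMap l => exact algebraMap_mem_fcSubring l
    | add x y _ _ hx hy => exact add_mem hx hy
    | mul x y _ _ hx hy => exact mul_mem hx hy
  have hBfin : Finite B := by
    have hmod : Module.Finite F (Subalgebra.toSubmodule B) := by
      rw [Algebra.adjoin_eq_span, Submonoid.closure_eq]
      exact Module.Finite.span_of_finite F hMfin
    exact Module.finite_of_finite F (M := Subalgebra.toSubmodule B)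
  have hcen : ∀ z : B, IsNilpotent z → ∀ b, Commute z b := by
    intro z hz b
    exact Subtype.ext (hH.commute_of_isNilpotent (hBfc z z.2) (hBfc b b.2) (hz.map B.val)).eq
  exact (Finite.isNilpotent_mul_sub_mul hcen ⟨u, Algebra.subset_adjoin huM⟩
    ⟨v, Algebra.subset_adjoin hvM⟩).map B.val

theorem IsOfFinOrder.isAlgebraic {F R : Type*} [Field F] [Ring R] [Algebra F R] {a : R}
    (ha : IsOfFinOrder a) : IsAlgebraic F a := by
  obtain ⟨n, hn, h⟩ := isOfFinOrder_iff_pow_eq_one.mp ha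
  exact ⟨Polynomial.X ^ n - 1, (Polynomial.monic_X_pow_sub_C 1 hn.ne').ne_zero, by simp [h]⟩

theorem IsOmegaSubgroup.isNilpotent_mul_sub_mul (F : Type*) {R : Type*} [Field F] [Ring R]
    [Algebra F R] {H : Subgroup Rˣ} (hH : IsOmegaSubgroup H) {u v : Rˣ}
    (hu : u ∈ fcTorsion Rˣ) (hv : v ∈ fcTorsion Rˣ) :
    IsNilpotent ((u : R) * v - v * u) := by
  have := hH.nontrivial
  rcases finite_or_infinite F with hF | hF
  · exact hH.isNilpotent_mul_sub_mul_of_finite F hu hv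
  · have hc : Commute (u : R) v := commute_of_isAlgebraic_of_infinite (F := F)
      (mem_fcRadical_iff_val_mem_fcSubring.mp hu.1) (Units.isOfFinOrder_val.mpr hv.2).isAlgebraic
    rw [hc.eq, sub_self]
    exact IsNilpotent.zero

/-! ### The FC-radical and its torsion part -/

/-- A unit which is algebraic over a finite field has finite order. -/
theorem isOfFinOrder_of_isAlgebraic_of_finite {F R : Type*} [Field F] [Finite F] [Ring R]
    [Algebra F R] {u : Rˣ} (hu : IsAlgebraic F (u : R)) : IsOfFinOrder u := by
  have hmod : Module.Finite F (Algebra.adjoin F {(u : R)}) :=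
    Algebra.finite_adjoin_simple_of_isIntegral hu.isIntegral
  have hfin : Finite (Algebra.adjoin F {(u : R)}) := Module.finite_of_finite F
  by_contra h
  have hinj := injective_pow_iff_not_isOfFinOrder.mpr h
  have : Function.Injective fun n : ℕ =>
      (⟨(u : R) ^ n, pow_mem (Algebra.self_mem_adjoin_singleton F _) n⟩ :
        Algebra.adjoin F {(u : R)}) := by
    intro m n hmn
    refine hinj (Units.ext ?_)
    simpa using hmn
  exact not_injective_infinite_finite _ this

/-- The FC-elements `u` with `u - 1` nilpotent form a subgroup because nilpotents are central in the
FC-subring; it contains the commutators `⁅u, v⁆ = 1 + (u * v - v * u) * (v * u)⁻¹` of torsion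
elements. -/
theorem IsOmegaSubgroup.isNilpotent_sub_one_of_mem_commutator (F : Type*) {R : Type*} [Field F]
    [Ring R] [Algebra F R] {H : Subgroup Rˣ} (hH : IsOmegaSubgroup H) {u : Rˣ}
    (hu : u ∈ ⁅fcTorsion Rˣ, fcTorsion Rˣ⁆) :
    u ∈ fcRadical Rˣ ∧ IsNilpotent ((u : R) - 1) := by
  have hfc {w : Rˣ} : w ∈ fcRadical Rˣ ↔ (w : R) ∈ fcSubring R :=
    mem_fcRadical_iff_val_mem_fcSubring
  let N : Subgroup Rˣ :=
    { carrier := {w | w ∈ fcRadical Rˣ ∧ IsNilpotent ((w : R) - 1)}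
      one_mem' := ⟨one_mem _, by simp⟩
      mul_mem' := by
        rintro a b ⟨ha, ha'⟩ ⟨hb, hb'⟩
        refine ⟨mul_mem ha hb, ?_⟩
        have hca : Commute ((a : R) - 1) b :=
          hH.commute_of_isNilpotent (sub_mem (hfc.mp ha) (one_mem _)) (hfc.mp hb) ha'
        have e : ((a * b : Rˣ) : R) - 1 = (a - 1) * b + (b - 1) := by
          rw [Units.val_mul]; noncomm_ring
        rw [e]
        refine Commute.isNilpotent_add ?_ (hca.isNilpotent_mul_right ha') hb'
        exact (hca.mul_left (Commute.refl _)).sub_right (Commute.one_right _)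
      inv_mem' := by
        rintro a ⟨ha, ha'⟩
        refine ⟨inv_mem ha, ?_⟩
        have hca : Commute ((a : R) - 1) ((a⁻¹ : Rˣ) : R) :=
          hH.commute_of_isNilpotent (sub_mem (hfc.mp ha) (one_mem _)) (hfc.mp (inv_mem ha)) ha'
        have e : ((a⁻¹ : Rˣ) : R) - 1 = -((a - 1) * ((a⁻¹ : Rˣ) : R)) := by
          rw [sub_mul, Units.mul_inv]; noncomm_ring
        rw [e]
        exact (hca.isNilpotent_mul_right ha').neg }
  suffices h : ⁅fcTorsion Rˣ, fcTorsion Rˣ⁆ ≤ N from h hu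
  rw [Subgroup.commutator_le]
  intro a ha b hb
  have hmem : ⁅a, b⁆ ∈ fcRadical Rˣ := by
    rw [commutatorElement_def]
    exact mul_mem (mul_mem (mul_mem ha.1 hb.1) (inv_mem ha.1)) (inv_mem hb.1)
  refine ⟨hmem, ?_⟩
  have hnil := hH.isNilpotent_mul_sub_mul F ha hb
  have hinv : (b * a)⁻¹ ∈ fcRadical Rˣ := inv_mem (mul_mem hb.1 ha.1)
  have hc : Commute ((a : R) * b - b * a) (((b * a)⁻¹ : Rˣ) : R) :=
    hH.commute_of_isNilpotent (sub_mem (mul_mem (hfc.mp ha.1) (hfc.mp hb.1))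
      (mul_mem (hfc.mp hb.1) (hfc.mp ha.1))) (hfc.mp hinv) hnil
  have e : ((⁅a, b⁆ : Rˣ) : R) - 1 = ((a : R) * b - b * a) * (((b * a)⁻¹ : Rˣ) : R) := by
    rw [sub_mul, ← Units.val_mul, ← Units.val_mul, ← Units.val_mul, ← Units.val_mul,
      mul_inv_cancel, Units.val_one, commutatorElement_def, mul_inv_rev, mul_assoc, mul_assoc]
  rw [e]
  exact hc.isNilpotent_mul_right hnil

theorem IsOmegaSubgroup.commute_of_mem_commutator (F : Type*) {R : Type*} [Field F]
    [Ring R] [Algebra F R] {H : Subgroup Rˣ} (hH : IsOmegaSubgroup H) {u v : Rˣ}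
    (hu : u ∈ ⁅fcTorsion Rˣ, fcTorsion Rˣ⁆) (hv : v ∈ fcRadical Rˣ) : u * v = v * u := by
  obtain ⟨h₁, h₂⟩ := hH.isNilpotent_sub_one_of_mem_commutator F hu
  have hc := hH.commute_of_isNilpotent
    (sub_mem (mem_fcRadical_iff_val_mem_fcSubring.mp h₁) (one_mem _))
    (mem_fcRadical_iff_val_mem_fcSubring.mp hv) h₂
  have := hc.add_left (Commute.one_left (v : R))
  rw [sub_add_cancel] at this
  exact Units.ext this.eq

theorem nilpotencyClass_le_two_of_commutator_commute {G : Type*} [Group G] {K : Subgroup G}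
    (hK : ∀ u ∈ ⁅K, K⁆, ∀ v ∈ K, u * v = v * u) :
    Group.IsNilpotent K ∧ Group.nilpotencyClass K ≤ 2 := by
  have h' : K.lowerCentralSeries 2 = ⊥ := by
    change ⁅⁅K, K⁆, K⁆ = ⊥
    rw [Subgroup.commutator_eq_bot_iff_le_centralizer]
    intro u hu
    rw [Subgroup.mem_centralizer_iff]
    exact fun v hv => (hK u hu v hv).symm
  -- The nilpotency class of `K` refers to the lower central series of `⊤ : Subgroup K`.
  have h : (⊤ : Subgroup K).lowerCentralSeries 2 = ⊥ := by
    rwa [← Subgroup.map_subtype_inj, Subgroup.map_bot, Subgroup.top_subtype_lowerCentralSeries]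
  have hn : Group.IsNilpotent K := Subgroup.isNilpotent_of_lowerCentralSeries_eq_bot h'
  exact ⟨hn, Subgroup.lowerCentralSeries_eq_bot_iff_nilpotencyClass_le.mp h⟩

theorem commutator_fcRadical_le_fcTorsion (G : Type*) [Group G] :
    ⁅fcRadical G, fcRadical G⁆ ≤ fcTorsion G := by
  rw [Subgroup.commutator_le]
  intro a ha b hb
  refine ⟨?_, isOfFinOrder_commutatorElement_of_mem_fcRadical ha hb⟩
  rw [commutatorElement_def]
  exact mul_mem (mul_mem (mul_mem ha hb) (inv_mem ha)) (inv_mem hb)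

theorem theorem2 {F R : Type*} [Field F] [Ring R] [Algebra F R]
    (hω : ∃ H : Subgroup Rˣ, IsOmegaSubgroup H) :
    (∀ u ∈ ⁅fcTorsion Rˣ, fcTorsion Rˣ⁆,
      IsUnipotentUnit u ∧ u ∈ fcRadical Rˣ ∧ ∀ v ∈ fcRadical Rˣ, u * v = v * u) ∧
    ((∀ a ∈ fcSubring R, IsAlgebraic F a) →
      Group.IsNilpotent (fcRadical Rˣ) ∧ Group.nilpotencyClass (fcRadical Rˣ) ≤ 2) ∧
    (Group.IsSolvable (fcRadical Rˣ) ∧ derivedSeries (fcRadical Rˣ) 3 = ⊥) ∧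
    (Group.IsNilpotent (fcTorsion Rˣ) ∧ Group.nilpotencyClass (fcTorsion Rˣ) ≤ 2) := by
  obtain ⟨H, hH⟩ := hω
  have hcen := fun {u v : Rˣ} => hH.commute_of_mem_commutator F (u := u) (v := v)
  refine ⟨fun u hu => ?_, fun halg => ?_, ?_, ?_⟩
  · obtain ⟨h₁, h₂⟩ := hH.isNilpotent_sub_one_of_mem_commutator F hu
    exact ⟨⟨(u : R) - 1, h₂, by abel⟩, h₁, fun v hv => hcen hu hv⟩
  · apply nilpotencyClass_le_two_of_commutator_commute
    rcases finite_or_infinite F with hF | hF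
    · have hle : fcRadical Rˣ ≤ fcTorsion Rˣ := fun u hu =>
        ⟨hu, isOfFinOrder_of_isAlgebraic_of_finite
          (halg u (mem_fcRadical_iff_val_mem_fcSubring.mp hu))⟩
      exact fun u hu v hv => hcen (Subgroup.commutator_mono hle hle hu) hv
    · have := hH.nontrivial
      intro u hu v hv
      have hu' : u ∈ fcRadical Rˣ := (commutator_fcRadical_le_fcTorsion _ hu).1
      exact Units.ext (commute_of_isAlgebraic_of_infinite (F := F)
        (mem_fcRadical_iff_val_mem_fcSubring.mp hu')
        (halg v (mem_fcRadical_iff_val_mem_fcSubring.mp hv))).eq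
  · have h : derivedSeries (fcRadical Rˣ) 3 = ⊥ := by
      have h1 : (derivedSeries (fcRadical Rˣ) 1).map (fcRadical Rˣ).subtype ≤ fcTorsion Rˣ := by
        rw [derivedSeries_one, Subgroup.map_subtype_commutator]
        exact commutator_fcRadical_le_fcTorsion _
      have h2 : (derivedSeries (fcRadical Rˣ) 2).map (fcRadical Rˣ).subtype ≤
          ⁅fcTorsion Rˣ, fcTorsion Rˣ⁆ := by
        rw [derivedSeries_succ, Subgroup.map_commutator]
        exact Subgroup.commutator_mono h1 h1
      rw [derivedSeries_succ, Subgroup.commutator_eq_bot_iff_le_centralizer]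
      intro a ha
      rw [Subgroup.mem_centralizer_iff]
      intro b _
      exact Subtype.ext (hcen (h2 ⟨a, ha, rfl⟩) b.2).symm
    exact ⟨⟨3, h⟩, h⟩
  · exact nilpotencyClass_le_two_of_commutator_commute fun u hu v hv => hcen hu hv.1
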